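/- Theorem. For every integer $p\ge 2$ there is a constant $c=c(p)>0$, depending only on $p$, such that for all pairwise distinct real numbers $x_1,\dots,x_p$ and all $U=(u_1,\dots,u_p)^T\in\mathbb R^p$, $$|AU|^2+\sup_{1\le k\le p}\left|U^T\,\frac{\partial A}{\partial x_k}\,U\right|\;\ge\; c\sum_{i=1}^p\sum_{j\ne i}\frac{u_j^2}{|x_i-x_j|^2},$$ where $|\cdot|$ is the Euclidean norm, $A=(a_{ij})_{1\le i,j\le p}$ is the matrix with $a_{ii}=0$ and $a_{ij}=1/|x_i-x_j|$ for $i\ne j$, and $\partial A/\partial x_k=(\partial a_{ij}/\partial x_k)_{1\le i,j\le p}$. In other words, the following statement about $p\geq 2$ points in $\mathbb R^m$ (conjectured by Bahri and Xu) holds for $m=1$ and every $p$: there is $c=c(p,m)>0$ such that the inequality above holds for all distinct $x_1,\dots,x_p\in\mathbb R^m$ and all $U\in\mathbb R^p$, where $\partial a_{ij}/\partial x_k\in\mathbb R^m$ is the gradient in $x_k$, and the absolute value $|U^T(\partial A/\partial x_k)U|$ is the Euclidean norm of a vector of $\mathbb R^m$. -/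

import Mathlib

open scoped Matrix BigOperators

noncomputable section

namespace BahriXu

/-- The `p × p` matrix `A` of the points `x₁, …, x_p` of `ℝᵐ`: its entries are `1 / |xᵢ - xⱼ|` off
the diagonal and `0` on the diagonal. -/
def invDistMatrix {p m : ℕ} (x : Fin p → EuclideanSpace ℝ (Fin m)) : Matrix (Fin p) (Fin p) ℝ :=
  Matrix.of fun i j => if i = j then 0 else 1 / ‖x i - x j‖

/-- The vector-valued `p × p` matrix `∂A/∂x_k`: its `(i, j)` entry is the gradient in `ℝᵐ` of
`a_{ij}` with respect to the `k`-th point, the other points being kept fixed. -/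
def partialInvDistMatrix {p m : ℕ} (x : Fin p → EuclideanSpace ℝ (Fin m)) (k : Fin p) :
    Matrix (Fin p) (Fin p) (EuclideanSpace ℝ (Fin m)) :=
  Matrix.of fun i j => gradient (fun y => invDistMatrix (Function.update x k y) i j) (x k)

/-- The value `Uᵀ B U` of the quadratic form of a vector-valued `p × p` matrix `B`. -/
def vectorQuadForm {p m : ℕ} (B : Matrix (Fin p) (Fin p) (EuclideanSpace ℝ (Fin m)))
    (U : EuclideanSpace ℝ (Fin p)) : EuclideanSpace ℝ (Fin m) :=
  ∑ i, ∑ j, (U i * U j) • B i j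

/-- The Bahri–Xu inequality for `p` points of `ℝᵐ`: there is a constant `c > 0`, depending only on
`p` and `m`, with
`|A U|² + sup_k |Uᵀ (∂A/∂x_k) U| ≥ c ∑_{i ≠ j} uⱼ² / |xᵢ - xⱼ|²`
for all distinct points `x₁, …, x_p` and all `U ∈ ℝᵖ`. -/
def Conjecture (p m : ℕ) : Prop :=
  ∃ c : ℝ, 0 < c ∧
    ∀ x : Fin p → EuclideanSpace ℝ (Fin m), Function.Injective x →
      ∀ U : EuclideanSpace ℝ (Fin p),
        c * ∑ i, ∑ j ∈ Finset.univ.erase i, U j ^ 2 / ‖x i - x j‖ ^ 2 ≤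
          ‖WithLp.toLp 2 (invDistMatrix x *ᵥ (U : Fin p → ℝ))‖ ^ 2 +
            ⨆ k : Fin p, ‖vectorQuadForm (partialInvDistMatrix x k) U‖

end BahriXu

end

namespace BahriXu

open Finset

/-- The integral of the product of two sign steps located at `a` and `b`. -/
theorem integral_step_mul_step {Y a b : ℝ} (ha : |a| ≤ Y) (hb : |b| ≤ Y) :
    ∫ t in (-Y)..Y, ((if t < a then (-1 : ℝ) else 1) * (if t < b then (-1 : ℝ) else 1))
      = 2 * Y - 2 * |a - b| := by
  wlog hab : a ≤ b generalizing a b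
  · rw [abs_sub_comm a b, ← this hb ha (le_of_not_ge hab)]
    simp only [mul_comm]
  rw [abs_le] at ha hb
  have hfun : (fun t : ℝ => (if t < a then (-1 : ℝ) else 1) * (if t < b then (-1 : ℝ) else 1))
      = fun t => 1 - 2 * (Set.Ico a b).indicator (fun _ => (1 : ℝ)) t := by
    funext t
    by_cases h1 : t < a
    · have h2 : t < b := h1.trans_le hab
      simp [h1, h2]
    · by_cases h2 : t < b
      · simp [h1, h2, not_lt.mp h1]; norm_num
      · simp [h1, h2]
  have hY : -Y ≤ Y := by linarith
  have hi : IntervalIntegrable ((Set.Ico a b).indicator (fun _ => (1 : ℝ)))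
      MeasureTheory.volume (-Y) Y := by
    rw [intervalIntegrable_iff]
    exact (MeasureTheory.integrable_indicator_iff measurableSet_Ico).2
      (by rw [MeasureTheory.integrableOn_const_iff]; right
          exact (MeasureTheory.Measure.restrict_apply_le _ _).trans_lt (by simp))
  rw [hfun, intervalIntegral.integral_sub (by simp) (hi.const_mul 2),
    intervalIntegral.integral_const_mul]
  have h3 : ∫ t in (-Y)..Y, (Set.Ico a b).indicator (fun _ => (1 : ℝ)) t = b - a := by
    rw [intervalIntegral.integral_of_le hY, ← MeasureTheory.integral_Icc_eq_integral_Ioc,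
      MeasureTheory.setIntegral_indicator measurableSet_Ico,
      Set.inter_eq_self_of_subset_right
        (show Set.Ico a b ⊆ Set.Icc (-Y) Y from
          fun z hz => ⟨ha.1.trans hz.1, hz.2.le.trans hb.2⟩)]
    simp [hab]
  rw [h3, abs_sub_comm, abs_of_nonneg (sub_nonneg.2 hab)]
  simp; ring

theorem intervalIntegrable_step_mul_step (s r a b : ℝ) :
    IntervalIntegrable (fun t : ℝ => (if t < a then (-1 : ℝ) else 1) *
      (if t < b then (-1 : ℝ) else 1)) MeasureTheory.volume s r := by
  refine (intervalIntegrable_const (c := (1 : ℝ))).mono_fun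
    (Measurable.aestronglyMeasurable ?_) (Filter.Eventually.of_forall fun t => ?_)
  · exact (Measurable.ite measurableSet_Iio measurable_const measurable_const).mul
      (Measurable.ite measurableSet_Iio measurable_const measurable_const)
  · dsimp only; split_ifs <;> norm_num

theorem intervalIntegrable_fun_sum {ι : Type*} [Fintype ι] {f : ι → ℝ → ℝ} {a b : ℝ}
    (hf : ∀ i, IntervalIntegrable (f i) MeasureTheory.volume a b) :
    IntervalIntegrable (fun t => ∑ i, f i t) MeasureTheory.volume a b := by
  have h : (fun t => ∑ i, f i t) = ∑ i, f i := by funext t; simp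
  rw [h]
  exact IntervalIntegrable.sum _ fun i _ => hf i

/-- A quantitative form of the conditional negative definiteness of `|a - b|`. -/
theorem gap_le_neg_sum_mul_abs_sub {ι : Type*} [Fintype ι] (w y : ι → ℝ) {Y g : ℝ}
    (hg : 0 < g) (j : ι) (hY : ∀ i, |y i| ≤ Y) (hj : |y j| + g ≤ Y)
    (hgap : ∀ i, i ≠ j → g ≤ |y i - y j|) :
    g * w j ^ 2 - Y * (∑ i, w i) ^ 2 ≤ -∑ k, ∑ i, w k * w i * |y k - y i| := by
  classical
  set σ : ι → ℝ → ℝ := fun i t => if t < y i then (-1 : ℝ) else 1 with hσ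
  set s : ℝ → ℝ := fun t => ∑ i, w i * σ i t with hs
  have hsq : ∀ t, s t ^ 2 = ∑ k, ∑ i, w k * w i * (σ k t * σ i t) := by
    intro t
    rw [pow_two, hs, Finset.sum_mul_sum]
    exact Finset.sum_congr rfl fun k _ => Finset.sum_congr rfl fun i _ => by ring
  have hint1 : ∀ a b k i, IntervalIntegrable (fun t => w k * w i * (σ k t * σ i t))
      MeasureTheory.volume a b := fun a b k i =>
    (intervalIntegrable_step_mul_step a b (y k) (y i)).const_mul _
  have hint : ∀ a b, IntervalIntegrable (fun t => s t ^ 2) MeasureTheory.volume a b := by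
    intro a b
    simp only [hsq]
    exact intervalIntegrable_fun_sum fun k => intervalIntegrable_fun_sum fun i => hint1 a b k i
  have htot : ∫ t in (-Y)..Y, s t ^ 2 =
      2 * Y * (∑ i, w i) ^ 2 - 2 * ∑ k, ∑ i, w k * w i * |y k - y i| := by
    simp only [hsq]
    rw [intervalIntegral.integral_finsetSum 
      (fun k _ => intervalIntegrable_fun_sum fun i => hint1 _ _ k i)]
    rw [pow_two, Finset.sum_mul_sum, Finset.mul_sum, Finset.mul_sum, ← Finset.sum_sub_distrib]
    refine Finset.sum_congr rfl fun k _ => ?_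
    rw [intervalIntegral.integral_finsetSum (fun i _ => hint1 _ _ k i), Finset.mul_sum,
      Finset.mul_sum, ← Finset.sum_sub_distrib]
    refine Finset.sum_congr rfl fun i _ => ?_
    rw [intervalIntegral.integral_const_mul, integral_step_mul_step (hY k) (hY i)]
    ring
  have hjY := abs_le.1 (hY j)
  have hjl : -Y ≤ y j - g := by have := neg_abs_le (y j); linarith
  have hjr : y j + g ≤ Y := by have := le_abs_self (y j); linarith
  have hsub : ∫ t in (y j - g)..(y j + g), s t ^ 2 ≤ ∫ t in (-Y)..Y, s t ^ 2 :=
    intervalIntegral.integral_mono_interval hjl (by linarith) hjr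
      (Filter.Eventually.of_forall fun t => sq_nonneg _) (hint _ _)
  have hsplit : ∫ t in (y j - g)..(y j + g), s t ^ 2 =
      ∫ t in (0 : ℝ)..g, (s (y j - t) ^ 2 + s (y j + t) ^ 2) := by
    rw [intervalIntegral.integral_add, intervalIntegral.integral_comp_sub_left
        (fun t => s t ^ 2), intervalIntegral.integral_comp_add_left (fun t => s t ^ 2)]
    · simp only [sub_zero, add_zero]
      exact (intervalIntegral.integral_add_adjacent_intervals (hint _ _) (hint _ _)).symm
    · simpa using (hint (y j - 0) (y j - g)).comp_sub_left (y j)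
    · simpa using (hint (y j + 0) (y j + g)).comp_add_left (y j)
  have hjump : ∀ t ∈ Set.Ioo (0 : ℝ) g, 2 * w j ^ 2 ≤ s (y j - t) ^ 2 + s (y j + t) ^ 2 := by
    intro t ht
    have hd : s (y j + t) - s (y j - t) = 2 * w j := by
      rw [hs, ← Finset.sum_sub_distrib, Finset.sum_eq_single j]
      · have h1 : ¬ y j + t < y j := by linarith [ht.1]
        have h2 : y j - t < y j := by linarith [ht.1]
        simp only [hσ, h1, h2, if_true, if_false]; ring
      · intro i _ hij
        have h1 : (y j + t < y i) ↔ (y j - t < y i) := by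
          rcases le_abs.1 (hgap i hij) with h | h
          · constructor <;> intro _ <;> linarith [ht.1, ht.2]
          · constructor <;> intro h' <;> linarith [ht.1, ht.2]
        simp only [hσ, h1]; ring
      · simp
    have hd2 : (s (y j + t) - s (y j - t)) ^ 2 = (2 * w j) ^ 2 := by rw [hd]
    nlinarith [sq_nonneg (s (y j + t) + s (y j - t))]
  have hlow : g * (2 * w j ^ 2) ≤ ∫ t in (0 : ℝ)..g, (s (y j - t) ^ 2 + s (y j + t) ^ 2) := by
    have h0 : ∫ _t in (0 : ℝ)..g, (2 * w j ^ 2) = g * (2 * w j ^ 2) := by simp; ring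
    rw [← h0]
    refine intervalIntegral.integral_mono_on_of_le_Ioo hg.le (by simp) ?_ hjump
    refine IntervalIntegrable.add ?_ ?_
    · simpa using (hint (y j - 0) (y j - g)).comp_sub_left (y j)
    · simpa using (hint (y j + 0) (y j + g)).comp_add_left (y j)
  linarith

/-- The potential at `c` of charges `u` at the points `x`; a charge located at `c` is left out. -/
noncomputable def potential {ι : Type*} [Fintype ι] (x u : ι → ℝ) (c : ℝ) : ℝ :=
  ∑ j, u j / |c - x j|

/-- The force on the `k`-th charge. -/
noncomputable def force {ι : Type*} [Fintype ι] (x u : ι → ℝ) (k : ι) : ℝ :=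
  u k * ∑ j, u j * (x k - x j) / |x k - x j| ^ 3

/-- Inversion at `c` turns a combination of the forces and the potentials into the energy of the
kernel `|a - b|`. -/
theorem sum_force_add_potential {ι : Type*} [Fintype ι] (x u : ι → ℝ)
    (hx : Function.Injective x) {c : ℝ} (hc : ∀ i, x i ≠ c) :
    ∑ k, (2 * (x k - c)⁻¹ * force x u k + ((x k - c)⁻¹) ^ 2 * u k * potential x u (x k)) =
      (∑ k, ∑ j, u k / |x k - c| * (u j / |x j - c|) * |(x k - c)⁻¹ - (x j - c)⁻¹|) / 2 := by
  have e1 : ∑ k, (2 * (x k - c)⁻¹ * force x u k + ((x k - c)⁻¹) ^ 2 * u k * potential x u (x k))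
      = ∑ k, ∑ j, (2 * (x k - c)⁻¹ * (u k * (u j * (x k - x j) / |x k - x j| ^ 3)) +
        ((x k - c)⁻¹) ^ 2 * u k * (u j / |x k - x j|)) := by
    refine Finset.sum_congr rfl fun k _ => ?_
    rw [force, potential, Finset.mul_sum, Finset.mul_sum, Finset.mul_sum,
      ← Finset.sum_add_distrib]
  have e2 := Finset.sum_comm (s := (Finset.univ : Finset ι)) (t := (Finset.univ : Finset ι))
    (f := fun k j => (2 * (x k - c)⁻¹ * (u k * (u j * (x k - x j) / |x k - x j| ^ 3)) +
        ((x k - c)⁻¹) ^ 2 * u k * (u j / |x k - x j|)))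
  rw [e1, eq_div_iff two_ne_zero, mul_two]
  nth_rewrite 2 [e2]
  rw [← Finset.sum_add_distrib]
  refine Finset.sum_congr rfl fun k _ => ?_
  rw [← Finset.sum_add_distrib]
  refine Finset.sum_congr rfl fun j _ => ?_
  by_cases hkj : k = j
  · subst hkj; simp
  have hk : x k - c ≠ 0 := sub_ne_zero.2 (hc k)
  have hj : x j - c ≠ 0 := sub_ne_zero.2 (hc j)
  have hd : x k - x j ≠ 0 := sub_ne_zero.2 (hx.ne hkj)
  have hy : (x k - c)⁻¹ - (x j - c)⁻¹ = -(x k - x j) / ((x k - c) * (x j - c)) := by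
    field_simp; ring
  rw [hy, abs_div, abs_mul, abs_neg, abs_sub_comm (x j) (x k)]
  have hD := abs_pos.2 hd
  have hK := abs_pos.2 hk
  have hJ := abs_pos.2 hj
  have s1 : |x k - x j| ^ 3 = |x k - x j| * (x k - x j) ^ 2 := by rw [← sq_abs (x k - x j)]; ring
  have s2 : u k / |x k - c| * (u j / |x j - c|) * (|x k - x j| / (|x k - c| * |x j - c|)) =
      u k * u j * (x k - x j) ^ 2 / ((x k - c) ^ 2 * (x j - c) ^ 2 * |x k - x j|) := by
    rw [← sq_abs (x k - c), ← sq_abs (x j - c), ← sq_abs (x k - x j)]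
    field_simp
  rw [s1, s2]
  field_simp
  ring


theorem exists_mem_Icc_forall_le_abs_sub {p : ℕ} (hp : 0 < p) (x : Fin p → ℝ) (c : ℝ) {L : ℝ}
    (hL : 0 < L) : ∃ c' ∈ Set.Icc c (c + L), ∀ i, L / (2 * p) ≤ |x i - c'| := by
  have hp' : (0 : ℝ) < p := Nat.cast_pos.2 hp
  by_contra! hcon
  have hmem : ∀ k : Fin (p + 1), c + L * (k : ℕ) / p ∈ Set.Icc c (c + L) := by
    intro k
    have hk : ((k : ℕ) : ℝ) ≤ p := by exact_mod_cast Nat.lt_succ_iff.1 k.2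
    constructor
    · have : 0 ≤ L * (k : ℕ) / p := by positivity
      linarith
    · have : L * (k : ℕ) / p ≤ L := by
        rw [div_le_iff₀ hp']; exact mul_le_mul_of_nonneg_left hk hL.le
      linarith
  choose i hi using fun k => hcon _ (hmem k)
  obtain ⟨a, b, hab, hiab⟩ := Fintype.exists_ne_map_eq_of_card_lt i (by simp)
  have h1 := abs_lt.1 (hi a)
  have h2 := abs_lt.1 (hi b)
  rw [hiab] at h1
  have h3 : |L * ((a : ℕ) : ℝ) / p - L * ((b : ℕ) : ℝ) / p| < L / p := by
    have : L / p = L / (2 * p) + L / (2 * p) := by field_simp; norm_num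
    rw [abs_lt]; constructor <;> linarith
  have h4 : (1 : ℝ) ≤ |((a : ℕ) : ℝ) - ((b : ℕ) : ℝ)| := by
    have : ((a : ℕ) : ℤ) - (b : ℕ) ≠ 0 := by
      intro h; exact hab (Fin.ext (by omega))
    exact_mod_cast Int.one_le_abs this
  rw [← sub_div, ← mul_sub, abs_div, abs_mul, abs_of_pos hL, abs_of_pos hp'] at h3
  have h5 := (div_lt_div_iff_of_pos_right hp').1 h3
  nlinarith

/-- Between two charges of opposite signs there is a point where the potential is zero, or a
location with zero charge. -/
theorem exists_potential_eq_zero {ι : Type*} [Fintype ι] (x u : ι → ℝ)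
    (hx : Function.Injective x) {k j : ι} (hk : 0 < u k) (hj : u j < 0) :
    ∃ c ∈ Set.uIcc (x k) (x j), (potential x u c = 0 ∨ ∃ i, c = x i) ∧
      ∀ i, x i = c → u i = 0 := by
  classical
  set P : ℝ → ℝ := fun t => ∑ i, u i * ∏ l ∈ univ.erase i, |t - x l| with hP
  have hcont : Continuous P := by
    refine continuous_finsetSum _ fun i _ => continuous_const.mul ?_
    exact continuous_finsetProd _ fun l _ => (continuous_id.sub continuous_const).abs
  have hPx : ∀ i, P (x i) = u i * ∏ l ∈ univ.erase i, |x i - x l| := by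
    intro i
    rw [hP]
    refine Finset.sum_eq_single i (fun b _ hb => ?_) (by simp)
    rw [Finset.prod_eq_zero (i := i) (by simp [hb.symm]) (by simp), mul_zero]
  have hpos : ∀ i, 0 < ∏ l ∈ univ.erase i, |x i - x l| := fun i =>
    Finset.prod_pos fun l hl => abs_pos.2 (sub_ne_zero.2 (hx.ne (Finset.ne_of_mem_erase hl).symm))
  have h0 : (0 : ℝ) ∈ Set.uIcc (P (x k)) (P (x j)) := by
    rw [Set.mem_uIcc, hPx, hPx]
    exact Or.inr ⟨(mul_neg_of_neg_of_pos hj (hpos j)).le, (mul_pos hk (hpos k)).le⟩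
  obtain ⟨c, hc, hPc⟩ := intermediate_value_uIcc hcont.continuousOn h0
  refine ⟨c, hc, ?_, ?_⟩
  · by_cases h : ∃ i, c = x i
    · exact Or.inr h
    · push Not at h
      left
      have hne : ∀ i, |c - x i| ≠ 0 := fun i => abs_ne_zero.2 (sub_ne_zero.2 (h i))
      have : potential x u c * ∏ l, |c - x l| = P c := by
        rw [potential, Finset.sum_mul]
        refine Finset.sum_congr rfl fun i _ => ?_
        rw [← Finset.mul_prod_erase univ (fun l => |c - x l|) (Finset.mem_univ i), ← mul_assoc,
          div_mul_cancel₀ _ (hne i)]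
      rw [hPc] at this
      exact (mul_eq_zero.1 this).resolve_right (Finset.prod_ne_zero_iff.2 fun i _ => hne i)
  · rintro i rfl
    rw [hPx] at hPc
    exact (mul_eq_zero.1 hPc).resolve_right (hpos i).ne'

theorem exists_small_potential_of_pos {p : ℕ} (x u : Fin p → ℝ) (hx : Function.Injective x)
    {τ : ℝ} (hτ : τ ≤ 1 / 2) (hV : ∀ k, |potential x u (x k)| ≤ τ) {k m : Fin p}
    (hkm : k ≠ m) (huk : u k = |x k - x m|) :
    ∃ c, |potential x u c| ≤ τ ∧ (∀ i, x i = c → u i = 0) ∧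
      ∃ i, 1 / (4 * p) ≤ |u i| / |x i - c| := by
  have hp : (0 : ℝ) < p := Nat.cast_pos.2 k.pos
  have hd : 0 < |x k - x m| := abs_pos.2 (sub_ne_zero.2 (hx.ne hkm))
  have hk0 : 0 < u k := huk ▸ hd
  obtain ⟨j, hj⟩ : ∃ j, u j / |x m - x j| ≤ -(1 / (2 * p)) := by
    by_contra! hcon
    have h1 : potential x u (x m) = 1 + ∑ j ∈ univ.erase k, u j / |x m - x j| := by
      rw [potential, ← Finset.add_sum_erase _ _ (Finset.mem_univ k), huk, abs_sub_comm (x m),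
        div_self hd.ne']
    have h2 : ∑ j ∈ univ.erase k, (-(1 / (2 * (p : ℝ)))) ≤
        ∑ j ∈ univ.erase k, u j / |x m - x j| := Finset.sum_le_sum fun j _ => (hcon j).le
    rw [Finset.sum_const, Finset.card_erase_of_mem (Finset.mem_univ k), nsmul_eq_mul,
      Finset.card_univ, Fintype.card_fin, Nat.cast_sub k.pos] at h2
    have h3 : ((p : ℝ) - (1 : ℕ)) * (-(1 / (2 * (p : ℝ)))) = -(1 / 2) + 1 / (2 * p) := by
      field_simp; push_cast; ring
    have h4 : 0 < 1 / (2 * (p : ℝ)) := by positivity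
    have h5 := (abs_le.1 (hV m)).2
    linarith
  have hxj : 0 < |x m - x j| := by
    rcases (abs_nonneg (x m - x j)).lt_or_eq with h | h
    · exact h
    · rw [← h, div_zero] at hj
      have : 0 < 1 / (2 * (p : ℝ)) := by positivity
      linarith
  rw [div_le_iff₀ hxj] at hj
  have hj0 : u j < 0 := by
    have : 0 < 1 / (2 * (p : ℝ)) * |x m - x j| := by positivity
    linarith
  obtain ⟨c, hc, hc1, hc2⟩ := exists_potential_eq_zero x u hx hk0 hj0
  refine ⟨c, ?_, hc2, ?_⟩
  · rcases hc1 with h | ⟨i, rfl⟩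
    · rw [h, abs_zero]; exact (abs_nonneg _).trans (hV k)
    · exact hV i
  have hck : 0 < |x k - c| := abs_pos.2 (sub_ne_zero.2 fun h => hk0.ne' (hc2 k h))
  have hcj : 0 < |x j - c| := abs_pos.2 (sub_ne_zero.2 fun h => hj0.ne (hc2 j h))
  have hck' : |x k - c| ≤ |x k - x j| := by
    rw [abs_sub_comm (x k), abs_sub_comm (x k)]; exact Set.abs_sub_left_of_mem_uIcc hc
  have hcj' : |x j - c| ≤ |x k - x j| := by
    rw [abs_sub_comm (x k)]; exact Set.abs_sub_right_of_mem_uIcc hc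
  have htri : |x k - x j| ≤ |x k - x m| + |x m - x j| := abs_sub_le _ _ _
  have hp1 : (1 : ℝ) ≤ p := by exact_mod_cast k.pos
  rcases le_total |x k - x m| |x m - x j| with h | h
  · refine ⟨j, ?_⟩
    rw [le_div_iff₀ hcj, abs_of_neg hj0]
    have h1 : 1 / (4 * (p : ℝ)) * |x j - c| ≤ 1 / (4 * (p : ℝ)) * (2 * |x m - x j|) := by
      gcongr; linarith
    have h2 : 1 / (4 * (p : ℝ)) * (2 * |x m - x j|) = 1 / (2 * p) * |x m - x j| := by
      field_simp; norm_num
    linarith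
  · refine ⟨k, ?_⟩
    rw [le_div_iff₀ hck, abs_of_pos hk0, huk]
    have h1 : 1 / (4 * (p : ℝ)) * |x k - c| ≤ 1 / 4 * (2 * |x k - x m|) := by
      gcongr
      · linarith
      · linarith
    linarith

theorem potential_neg {ι : Type*} [Fintype ι] (x u : ι → ℝ) (c : ℝ) :
    potential x (-u) c = -potential x u c := by
  simp [potential, neg_div]

theorem exists_small_potential {p : ℕ} (x u : Fin p → ℝ) (hx : Function.Injective x)
    {τ : ℝ} (hτ : τ ≤ 1 / 2) (hV : ∀ k, |potential x u (x k)| ≤ τ) {k m : Fin p}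
    (hkm : k ≠ m) (huk : |u k| = |x k - x m|) :
    ∃ c, |potential x u c| ≤ τ ∧ (∀ i, x i = c → u i = 0) ∧
      ∃ i, 1 / (4 * p) ≤ |u i| / |x i - c| := by
  rcases abs_choice (u k) with h | h
  · exact exists_small_potential_of_pos x u hx hτ hV hkm (h ▸ huk)
  · obtain ⟨c, h1, h2, h3⟩ := exists_small_potential_of_pos x (-u) hx hτ
      (fun k => by rw [potential_neg, abs_neg]; exact hV k) hkm (by rw [Pi.neg_apply, ← h, huk])
    exact ⟨c, by rwa [potential_neg, abs_neg] at h1, by simpa using h2, by simpa using h3⟩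

theorem abs_div_abs_sub_le {p : ℕ} (x u : Fin p → ℝ)
    (hu : ∀ i j, i ≠ j → |u j| ≤ |x i - x j|) {c : ℝ} (hc : |potential x u c| ≤ 2) (i : Fin p) :
    |u i| / |x i - c| ≤ 2 * p := by
  have hp1 : (1 : ℝ) ≤ p := by exact_mod_cast i.pos
  obtain ⟨k, -, hk⟩ := Finset.exists_min_image univ (fun i => |x i - c|) ⟨i, Finset.mem_univ i⟩
  have h2 : ∀ j, j ≠ k → abs (u j / |c - x j|) ≤ 2 := by
    intro j hj
    rw [abs_div, abs_abs, abs_sub_comm c]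
    refine div_le_of_le_mul₀ (abs_nonneg _) (by norm_num) ((hu k j hj.symm).trans ?_)
    have h3 := hk j (Finset.mem_univ j)
    have h4 := abs_sub_le (x k) c (x j)
    rw [abs_sub_comm c] at h4
    linarith
  by_cases hik : i = k
  · subst hik
    have h5 : abs (∑ j ∈ univ.erase i, u j / |c - x j|) ≤ ∑ j ∈ univ.erase i, (2 : ℝ) :=
      (Finset.abs_sum_le_sum_abs _ _).trans
        (Finset.sum_le_sum fun j hj => h2 j (Finset.ne_of_mem_erase hj))
    rw [Finset.sum_const, Finset.card_erase_of_mem (Finset.mem_univ i), nsmul_eq_mul,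
      Finset.card_univ, Fintype.card_fin, Nat.cast_sub i.pos] at h5
    rw [potential, ← Finset.add_sum_erase _ _ (Finset.mem_univ i)] at hc
    have h6 : |u i| / |x i - c| = abs (u i / |c - x i|) := by
      rw [abs_div, abs_abs, abs_sub_comm c]
    rw [h6]
    rw [abs_le] at hc h5 ⊢
    push_cast at h5
    constructor <;> linarith
  · have := h2 i hik
    rw [abs_div, abs_abs, abs_sub_comm c] at this
    linarith

/-- A decreasing sequence of thresholds leaves one of any `p` intervals free of `p` numbers, if one
of them is above all thresholds. -/
theorem exists_threshold {p : ℕ} (a : Fin p → ℝ) (t : ℕ → ℝ) (ht : StrictAnti t) {i₀ : Fin p}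
    (hi : t 0 ≤ a i₀) : ∃ n < p, ∀ i, a i < t (n + 1) ∨ t n ≤ a i := by
  by_contra! hcon
  choose f hf using fun n : Fin p => hcon n n.2
  have hinj : Function.Injective f := by
    intro m n hmn
    by_contra hne
    have h1 := hf m
    have h2 := hf n
    rw [hmn] at h1
    rcases lt_or_gt_of_ne hne with h | h
    · have : t n ≤ t (m + 1) := ht.antitone (Nat.succ_le_of_lt h)
      linarith
    · have : t m ≤ t (n + 1) := ht.antitone (Nat.succ_le_of_lt h)
      linarith
  obtain ⟨n, hn⟩ := (Finite.injective_iff_surjective.1 hinj) i₀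
  have h1 := (hf n).2
  rw [hn] at h1
  have : t n ≤ t 0 := ht.antitone (Nat.zero_le _)
  linarith


set_option maxHeartbeats 1000000 in
/-- No configuration has small potentials and forces, if at some point `c` of small potential the
charges, relative to their distances from `c`, are either very small or not small. -/
theorem false_of_small_potential_of_small_force {p : ℕ} (hp : 2 ≤ p) (x u : Fin p → ℝ)
    (hx : Function.Injective x) (hu : ∀ i j, i ≠ j → |u j| ≤ |x i - x j|)
    {κ η : ℝ} (hκ : 0 < κ) (hκ1 : κ ≤ 1) (hη : 10000 * (p : ℝ) ^ 5 * η = κ ^ 3)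
    (hV : ∀ k, |potential x u (x k)| ≤ η ^ 2) (hF : ∀ k, |force x u k| ≤ η ^ 2)
    {c : ℝ} (hc : |potential x u c| ≤ η ^ 2) (hc0 : ∀ i, x i = c → u i = 0)
    (hdich : ∀ i, |u i| / |x i - c| < η ^ 2 ∨ κ ≤ |u i| / |x i - c|)
    (hex : ∃ i, κ ≤ |u i| / |x i - c|) : False := by
  have hp2 : (2 : ℝ) ≤ p := by exact_mod_cast hp
  have hp0 : (0 : ℝ) < p := by linarith
  have hη0 : 0 < η := by
    have : 0 < 10000 * (p : ℝ) ^ 5 * η := hη ▸ pow_pos hκ 3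
    exact pos_of_mul_pos_right this (by positivity)
  have hpη : p * η ≤ 1 / 10000 := by
    have h1 : κ ^ 3 ≤ 1 := pow_le_one₀ hκ.le hκ1
    have h2 : (p : ℝ) ≤ p ^ 5 := le_self_pow₀ (by linarith) (by norm_num)
    have h3 : p * η ≤ p ^ 5 * η := by gcongr
    linarith
  have hη1 : η ≤ 1 / 10000 := by nlinarith
  have hηsq : η ^ 2 ≤ η := by nlinarith
  have hW := abs_div_abs_sub_le x u hu (c := c) (by linarith)
  obtain ⟨j, hjmem, hjmin⟩ := Finset.exists_min_image
    (univ.filter fun i => κ ≤ |u i| / |x i - c|) (fun i => |x i - c|)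
    (by obtain ⟨i, hi⟩ := hex; exact ⟨i, by simpa using hi⟩)
  have hj : κ ≤ |u j| / |x j - c| := by simpa using hjmem
  set ρ := |x j - c| with hρ
  have hρ0 : 0 < ρ := by
    rcases (abs_nonneg (x j - c)).lt_or_eq with h | h
    · exact h
    · rw [hρ, ← h, div_zero] at hj; linarith
  have huj : κ * ρ ≤ |u j| := (le_div_iff₀ hρ0).1 hj
  obtain ⟨c', hc', hfar⟩ := exists_mem_Icc_forall_le_abs_sub (by omega) x c (mul_pos hη0 hρ0)
  set r := η * ρ / (2 * p) with hr
  have hr0 : 0 < r := by positivity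
  have hrinv : 1 / r = 2 * p / (η * ρ) := by rw [hr, one_div_div]
  have hcc : |c' - c| ≤ η * ρ := by
    rw [abs_le]; constructor <;> linarith [hc'.1, hc'.2, mul_pos hη0 hρ0]
  have hηρ : η * ρ ≤ ρ / 10000 := by nlinarith
  have hD : ∀ i, 0 < |x i - c'| := fun i => hr0.trans_le (hfar i)
  have hne : ∀ i, x i ≠ c' := fun i h => by
    have := hD i; rw [h, sub_self, abs_zero] at this; linarith
  have hDc : ∀ i, abs (|x i - c'| - |x i - c|) ≤ η * ρ := fun i => by
    refine (abs_abs_sub_abs_le_abs_sub _ _).trans ?_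
    rw [sub_sub_sub_cancel_left, abs_sub_comm]; exact hcc
  have hbound : ∀ i, |u i| / |x i - c'| ≤ 4 * p ∧
      abs (u i / |x i - c'| - u i / |x i - c|) ≤ 4 * p * η := by
    intro i
    rcases lt_or_ge (|x i - c|) ρ with hlt | hge
    · have hai : |u i| / |x i - c| < η ^ 2 := by
        refine (hdich i).resolve_right fun h => ?_
        have := hjmin i (by simpa using h)
        linarith
      have hui : |u i| ≤ η ^ 2 * ρ := by
        rcases (abs_nonneg (x i - c)).lt_or_eq with h | h
        · have := (div_lt_iff₀ h).1 hai
          have h2 : η ^ 2 * |x i - c| ≤ η ^ 2 * ρ := by gcongr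
          linarith
        · rw [hc0 i (sub_eq_zero.1 (abs_eq_zero.1 h.symm)), abs_zero]; positivity
      have h1 : |u i| / |x i - c'| ≤ 2 * p * η := by
        calc |u i| / |x i - c'| ≤ η ^ 2 * ρ / r := by gcongr; exact hfar i
          _ = 2 * p * η := by rw [hr]; field_simp
      refine ⟨by nlinarith, ?_⟩
      calc abs (u i / |x i - c'| - u i / |x i - c|)
          ≤ abs (u i / |x i - c'|) + abs (u i / |x i - c|) := abs_sub _ _
        _ = |u i| / |x i - c'| + |u i| / |x i - c| := by simp only [abs_div, abs_abs]
        _ ≤ 4 * p * η := by nlinarith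
    · have hi0 : 0 < |x i - c| := hρ0.trans_le hge
      have hDi := abs_le.1 (hDc i)
      have hhalf : |x i - c| / 2 ≤ |x i - c'| := by linarith
      have ha : |u i| ≤ 2 * p * |x i - c| := (div_le_iff₀ hi0).1 (hW i)
      constructor
      · rw [div_le_iff₀ (hD i)]; nlinarith
      · have e : u i / |x i - c'| - u i / |x i - c| =
            u i * (|x i - c| - |x i - c'|) / (|x i - c'| * |x i - c|) := by
          have := (hD i).ne'
          field_simp
        rw [e, abs_div, abs_mul, abs_mul, abs_abs, abs_abs, abs_sub_comm (|x i - c|),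
          div_le_iff₀ (mul_pos (hD i) hi0)]
        calc |u i| * abs (|x i - c'| - |x i - c|) ≤ 2 * p * |x i - c| * (η * ρ) := by
              gcongr; exact hDc i
          _ ≤ 2 * p * |x i - c| * (η * (2 * |x i - c'|)) := by gcongr; linarith
          _ = 4 * p * η * (|x i - c'| * |x i - c|) := by ring
  set T := ∑ i, u i / |x i - c'| with hT
  have hTle : |T| ≤ 5 * p ^ 2 * η := by
    have h1 : T = potential x u c + ∑ i, (u i / |x i - c'| - u i / |x i - c|) := by
      rw [hT, potential, ← Finset.sum_add_distrib]
      refine Finset.sum_congr rfl fun i _ => ?_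
      rw [abs_sub_comm c]; ring
    have h2 : |∑ i, (u i / |x i - c'| - u i / |x i - c|)| ≤ ∑ _i : Fin p, 4 * p * η :=
      (Finset.abs_sum_le_sum_abs _ _).trans (Finset.sum_le_sum fun i _ => (hbound i).2)
    rw [Finset.sum_const, Finset.card_univ, Fintype.card_fin, nsmul_eq_mul] at h2
    rw [h1]
    refine (abs_add_le _ _).trans ?_
    have h3 : η ≤ p ^ 2 * η := le_mul_of_one_le_left hη0.le (one_le_pow₀ (by linarith))
    nlinarith
  have hDj : |x j - c'| ≤ 2 * ρ := by have := (abs_le.1 (hDc j)).2; linarith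
  have hg0 : 0 < κ / (8 * ρ) := by positivity
  have hrρ : r ≤ ρ := by
    rw [hr, div_le_iff₀ (by positivity)]; nlinarith
  have hgr : κ / (8 * ρ) ≤ 1 / r := by
    rw [div_le_div_iff₀ (by positivity) hr0]; nlinarith
  have hyr : ∀ i, |(x i - c')⁻¹| ≤ 1 / r := fun i => by
    rw [abs_inv, ← one_div]; exact one_div_le_one_div_of_le hr0 (hfar i)
  have hrpos : 0 < 1 / r := by positivity
  have hgap := gap_le_neg_sum_mul_abs_sub (fun i => u i / |x i - c'|) (fun i => (x i - c')⁻¹)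
    (Y := 2 * (1 / r)) hg0 j (fun i => (hyr i).trans (by linarith))
    (by have := hyr j; linarith) (by
      intro i hij
      have hi' := sub_ne_zero.2 (hne i)
      have hj' := sub_ne_zero.2 (hne j)
      have e : (x i - c')⁻¹ - (x j - c')⁻¹ = (x j - x i) / ((x i - c') * (x j - c')) := by
        field_simp; ring
      rw [e, abs_div, abs_mul, abs_sub_comm (x j), le_div_iff₀ (mul_pos (hD i) (hD j)),
        div_mul_eq_mul_div, div_le_iff₀ (by positivity)]
      have htri : |x i - c'| ≤ |x i - x j| + |x j - c'| := abs_sub_le _ _ _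
      have hDi := hD i
      have hDj0 := hD j
      rcases le_total (|x j - c'|) (|x i - x j|) with h | h
      · calc κ * (|x i - c'| * |x j - c'|) ≤ 1 * ((2 * |x i - x j|) * (2 * ρ)) := by
              gcongr; linarith
          _ ≤ |x i - x j| * (8 * ρ) := by nlinarith [abs_nonneg (x i - x j)]
      · calc κ * (|x i - c'| * |x j - c'|) ≤ κ * ((4 * ρ) * (2 * ρ)) := by
              gcongr; linarith
          _ = (κ * ρ) * (8 * ρ) := by ring
          _ ≤ |x i - x j| * (8 * ρ) := by
              gcongr; exact huj.trans (hu i j hij))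
  have hid := sum_force_add_potential x u hx hne
  have hsum : |∑ k, (2 * (x k - c')⁻¹ * force x u k +
      ((x k - c')⁻¹) ^ 2 * u k * potential x u (x k))| ≤
      ∑ _k : Fin p, (2 + 4 * p) * η ^ 2 * (1 / r) := by
    refine (Finset.abs_sum_le_sum_abs _ _).trans (Finset.sum_le_sum fun k _ => ?_)
    refine (abs_add_le _ _).trans ?_
    have h1 : |2 * (x k - c')⁻¹ * force x u k| ≤ 2 * (1 / r) * η ^ 2 := by
      rw [abs_mul, abs_mul, abs_two]
      gcongr
      · exact hyr k
      · exact hF k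
    have h2 : |((x k - c')⁻¹) ^ 2 * u k * potential x u (x k)| ≤ (1 / r) * (4 * p) * η ^ 2 := by
      have e : ((x k - c')⁻¹) ^ 2 * u k * potential x u (x k) =
          (x k - c')⁻¹ * ((x k - c')⁻¹ * u k) * potential x u (x k) := by ring
      rw [e, abs_mul, abs_mul]
      gcongr
      · exact hyr k
      · rw [abs_mul, abs_inv, inv_mul_eq_div]; exact (hbound k).1
      · exact hV k
    linarith
  rw [hid, Finset.sum_const, Finset.card_univ, Fintype.card_fin, nsmul_eq_mul] at hsum
  have hsum' := (abs_le.1 hsum).1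
  have hwj : κ / 2 ≤ abs (u j / |x j - c'|) := by
    rw [abs_div, abs_abs, le_div_iff₀ (hD j)]; nlinarith
  have hwj2 : (κ / 2) ^ 2 ≤ (u j / |x j - c'|) ^ 2 := by
    rw [← sq_abs (u j / _)]; gcongr
  have hT2 : T ^ 2 ≤ (5 * p ^ 2 * η) ^ 2 := by rw [← sq_abs T]; gcongr
  have hmain : κ / (8 * ρ) * (κ / 2) ^ 2 ≤
      2 * (1 / r) * (5 * p ^ 2 * η) ^ 2 + 2 * (p * ((2 + 4 * p) * η ^ 2 * (1 / r))) := by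
    have h1 : κ / (8 * ρ) * (κ / 2) ^ 2 ≤ κ / (8 * ρ) * (u j / |x j - c'|) ^ 2 := by gcongr
    have h2 : 2 * (1 / r) * T ^ 2 ≤ 2 * (1 / r) * (5 * p ^ 2 * η) ^ 2 := by gcongr
    linarith
  rw [hrinv] at hmain
  have e1 : κ / (8 * ρ) * (κ / 2) ^ 2 = κ ^ 3 / 32 / ρ := by field_simp; norm_num
  have e2 : 2 * (2 * p / (η * ρ)) * (5 * p ^ 2 * η) ^ 2 +
      2 * (p * ((2 + 4 * p) * η ^ 2 * (2 * p / (η * ρ)))) =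
      (100 * p ^ 5 * η + 4 * p ^ 2 * (2 + 4 * p) * η) / ρ := by field_simp; ring
  rw [e1, e2, div_le_div_iff_of_pos_right hρ0, ← hη] at hmain
  have h3 : (p : ℝ) ^ 2 * (2 + 4 * p) ≤ 5 * p ^ 5 := by
    have h4 : (p : ℝ) ^ 3 ≤ p ^ 5 := pow_le_pow_right₀ (by linarith) (by norm_num)
    nlinarith [sq_nonneg (p : ℝ)]
  have h5 : 0 < (p : ℝ) ^ 5 * η := by positivity
  have h6 : (p : ℝ) ^ 2 * (2 + 4 * p) * η ≤ 5 * p ^ 5 * η := by gcongr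
  linarith

/-- The successive thresholds separating small from large charges. -/
noncomputable def threshold (p : ℕ) : ℕ → ℝ
  | 0 => 1 / (4 * p)
  | n + 1 => (threshold p n ^ 3 / (10000 * (p : ℝ) ^ 5)) ^ 2

theorem threshold_pos_le_one {p : ℕ} (hp : 0 < p) (n : ℕ) :
    0 < threshold p n ∧ threshold p n ≤ 1 := by
  have hp1 : (1 : ℝ) ≤ p := by exact_mod_cast hp
  induction n with
  | zero =>
    rw [threshold]
    exact ⟨by positivity, by rw [div_le_one (by positivity)]; linarith⟩
  | succ n ih =>
    have h0 := ih.1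
    rw [threshold]
    refine ⟨by positivity, pow_le_one₀ (by positivity) ?_⟩
    rw [div_le_one (by positivity)]
    have h1 : threshold p n ^ 3 ≤ 1 := pow_le_one₀ h0.le ih.2
    have h2 : (1 : ℝ) ≤ (p : ℝ) ^ 5 := one_le_pow₀ hp1
    linarith

theorem threshold_strictAnti {p : ℕ} (hp : 0 < p) : StrictAnti (threshold p) := by
  have hp1 : (1 : ℝ) ≤ p := by exact_mod_cast hp
  refine strictAnti_nat_of_succ_lt fun n => ?_
  obtain ⟨h0, h1⟩ := threshold_pos_le_one hp n
  have h2 : (1 : ℝ) ≤ (p : ℝ) ^ 5 := one_le_pow₀ hp1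
  have h3 : threshold p n ^ 3 ≤ threshold p n := pow_le_of_le_one h0.le h1 (by norm_num)
  have h4 : threshold p n ^ 3 / (10000 * (p : ℝ) ^ 5) ≤ threshold p n / 10000 := by
    rw [div_le_div_iff₀ (by positivity) (by norm_num)]
    nlinarith [pow_pos h0 3]
  have h5 : (threshold p n ^ 3 / (10000 * (p : ℝ) ^ 5)) ^ 2 ≤ (threshold p n / 10000) ^ 2 := by
    gcongr
  rw [threshold]
  nlinarith

/-- Charges bounded by the distances between them, with equality somewhere, cannot have small
potentials and small forces. -/
theorem exists_threshold_lt {p : ℕ} (hp : 2 ≤ p) (x u : Fin p → ℝ)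
    (hx : Function.Injective x) (hu : ∀ i j, i ≠ j → |u j| ≤ |x i - x j|)
    {k m : Fin p} (hkm : k ≠ m) (huk : |u k| = |x k - x m|) :
    ∃ i, threshold p p < |potential x u (x i)| ∨ threshold p p < |force x u i| := by
  have hp0 : 0 < p := by omega
  by_contra! hcon
  have hanti := threshold_strictAnti hp0
  have hτ : threshold p p ≤ 1 / 2 := by
    have h1 : threshold p p ≤ threshold p 0 := hanti.antitone (Nat.zero_le _)
    have h2 : threshold p 0 ≤ 1 / 2 := by
      have hp2 : (2 : ℝ) ≤ p := by exact_mod_cast hp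
      rw [threshold]
      exact one_div_le_one_div_of_le (by norm_num) (by linarith)
    linarith
  obtain ⟨c, hc, hc0, i₀, hi₀⟩ := exists_small_potential x u hx hτ (fun k => (hcon k).1) hkm huk
  obtain ⟨n, hn, hdich⟩ := exists_threshold (fun i => |u i| / |x i - c|) (threshold p) hanti hi₀
  obtain ⟨h0, h1⟩ := threshold_pos_le_one hp0 n
  have hle : threshold p p ≤ (threshold p n ^ 3 / (10000 * (p : ℝ) ^ 5)) ^ 2 :=
    hanti.antitone (Nat.succ_le_of_lt hn)
  refine false_of_small_potential_of_small_force hp x u hx hu h0 h1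
    (η := threshold p n ^ 3 / (10000 * (p : ℝ) ^ 5)) ?_ (fun k => (hcon k).1.trans hle)
    (fun k => (hcon k).2.trans hle) (hc.trans hle) hc0 hdich
    ⟨i₀, (hanti.antitone (Nat.zero_le n)).trans hi₀⟩
  have hp' : (0 : ℝ) < p := by exact_mod_cast hp0
  field_simp


theorem hasGradientAt_one_div_norm_sub {E : Type*} [NormedAddCommGroup E] [InnerProductSpace ℝ E]
    [CompleteSpace E] {a z : E} (h : z ≠ a) :
    HasGradientAt (fun y : E => 1 / ‖y - a‖) (-(1 / ‖z - a‖ ^ 3) • (z - a)) z := by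
  have hz : ‖z - a‖ ≠ 0 := norm_ne_zero_iff.2 (sub_ne_zero.2 h)
  have h1 : HasFDerivAt (fun y : E => ‖y - a‖ ^ 2) (2 • (innerSL ℝ (z - a))) z := by
    simpa using ((hasFDerivAt_id z).sub_const a).norm_sq
  have hz' : √(‖z - a‖ ^ 2) ≠ 0 := by rwa [Real.sqrt_sq (norm_nonneg _)]
  have h2 := (hasDerivAt_inv hz').comp_hasFDerivAt z (h1.sqrt (by positivity))
  rw [hasGradientAt_iff_hasFDerivAt]
  refine (h2.congr_of_eventuallyEq (Filter.Eventually.of_forall fun y => ?_)).congr_fderiv ?_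
  · simp [Real.sqrt_sq]
  · ext v
    simp [Real.sqrt_sq]
    field_simp

/-- A quadratic form in the entries of `∂A/∂x_k` is twice the force on the `k`-th charge. -/
theorem vectorQuadForm_partialInvDistMatrix_apply {p : ℕ}
    (x : Fin p → EuclideanSpace ℝ (Fin 1)) (hx : Function.Injective x)
    (U : EuclideanSpace ℝ (Fin p)) (k : Fin p) :
    vectorQuadForm (partialInvDistMatrix x k) U 0 = -2 * force (fun i => x i 0) U k := by
  have hnorm : ∀ v : EuclideanSpace ℝ (Fin 1), ‖v‖ = |v 0| := fun v => by
    simp [EuclideanSpace.norm_eq, Real.sqrt_sq_eq_abs]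
  have hne : ∀ i, i ≠ k → x k ≠ x i := fun i hi => hx.ne hi.symm
  set G : Fin p → EuclideanSpace ℝ (Fin 1) := fun j =>
    -(1 / ‖x k - x j‖ ^ 3) • (x k - x j) with hG
  have hGk : G k = 0 := by simp [hG]
  have hB : ∀ i j, partialInvDistMatrix x k i j =
      (if i = k then G j else 0) + (if j = k then G i else 0) := by
    intro i j
    simp only [partialInvDistMatrix, invDistMatrix, Matrix.of_apply]
    by_cases hij : i = j
    · subst hij
      have : (if i = k then G i else 0) = 0 := by
        split_ifs with h
        · rw [h, hGk]
        · rfl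
      simp [this]
    · simp only [hij, if_false]
      by_cases hi : i = k
      · subst hi
        have hj : j ≠ i := fun h => hij h.symm
        simp only [Function.update_self, Function.update_of_ne hj, if_true, hj, if_false, add_zero]
        exact (hasGradientAt_one_div_norm_sub (hne j hj)).gradient
      · by_cases hj : j = k
        · subst hj
          simp only [Function.update_self, Function.update_of_ne hi, if_true, hi, if_false,
            zero_add, norm_sub_rev (x i)]
          exact (hasGradientAt_one_div_norm_sub (hne i hi)).gradient
        · simp [hi, hj]
  have hS : vectorQuadForm (partialInvDistMatrix x k) U = (2 * U k) • ∑ j, U j • G j := by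
    simp only [vectorQuadForm, hB, smul_add, Finset.sum_add_distrib, smul_ite, smul_zero]
    rw [Finset.sum_comm]
    simp only [Finset.sum_ite_eq', Finset.mem_univ, if_true]
    rw [two_mul, add_smul, Finset.smul_sum]
    simp only [smul_smul, mul_comm]
  rw [hS, force]
  simp only [PiLp.smul_apply, smul_eq_mul, WithLp.ofLp_sum, Finset.sum_apply, hG, hnorm,
    PiLp.sub_apply]
  rw [Finset.mul_sum, Finset.mul_sum, Finset.mul_sum]
  refine Finset.sum_congr rfl fun j _ => ?_
  ring


theorem exists_threshold_mul_lt {p : ℕ} (hp : 2 ≤ p) (x u : Fin p → ℝ)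
    (hx : Function.Injective x) {M : ℝ} (hM : 0 < M)
    (hu : ∀ i j, i ≠ j → |u j| ≤ M * |x i - x j|)
    {k m : Fin p} (hkm : k ≠ m) (huk : |u k| = M * |x k - x m|) :
    ∃ i, threshold p p * M < |potential x u (x i)| ∨
      threshold p p * M ^ 2 < |force x u i| := by
  have hV : ∀ i, |potential x (fun j => u j / M) (x i)| = |potential x u (x i)| / M := by
    intro i
    rw [← abs_of_pos hM, ← abs_div, abs_of_pos hM, potential, potential, Finset.sum_div]
    simp only [div_right_comm]
  have hF : ∀ i, |force x (fun j => u j / M) i| = |force x u i| / M ^ 2 := by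
    intro i
    have h : force x (fun j => u j / M) i = force x u i / M ^ 2 := by
      rw [force, force, Finset.mul_sum, Finset.mul_sum, Finset.sum_div]
      refine Finset.sum_congr rfl fun j _ => ?_
      ring
    rw [h, abs_div, abs_of_pos (pow_pos hM 2)]
  obtain ⟨i, hi⟩ := exists_threshold_lt hp x (fun j => u j / M) hx
    (fun i j hij => by
      rw [abs_div, abs_of_pos hM, div_le_iff₀ hM, mul_comm]; exact hu i j hij)
    hkm (by rw [abs_div, abs_of_pos hM, huk, mul_div_cancel_left₀ _ hM.ne'])
  rw [hV, hF, lt_div_iff₀ hM, lt_div_iff₀ (pow_pos hM 2)] at hi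
  exact ⟨i, hi⟩

theorem toLp_invDistMatrix_mulVec_apply {p : ℕ} (x : Fin p → EuclideanSpace ℝ (Fin 1))
    (U : EuclideanSpace ℝ (Fin p)) (k : Fin p) :
    (invDistMatrix x *ᵥ (U : Fin p → ℝ)) k = potential (fun i => x i 0) U (x k 0) := by
  simp only [Matrix.mulVec, dotProduct, invDistMatrix, Matrix.of_apply, potential]
  refine Finset.sum_congr rfl fun j _ => ?_
  split_ifs with h
  · simp [h]
  · simp [EuclideanSpace.norm_eq, Real.sqrt_sq_eq_abs, div_eq_inv_mul]

end BahriXu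

open BahriXu in
theorem mainTheorem3 (p : ℕ) (hp : 2 ≤ p) : BahriXu.Conjecture p 1 := by
  have hp0 : 0 < p := by omega
  have hpR : (0 : ℝ) < p := by exact_mod_cast hp0
  obtain ⟨hτ0, hτ1⟩ := threshold_pos_le_one hp0 p
  set τ := threshold p p with hτ
  refine ⟨τ ^ 2 / p ^ 2, by positivity, fun x hx U => ?_⟩
  have hxs : Function.Injective fun i => x i 0 := by
    intro i j hij
    refine hx (PiLp.ext fun l => ?_)
    rw [Fin.fin_one_eq_zero l]; exact hij
  have hnorm : ∀ i j, ‖x i - x j‖ = |x i 0 - x j 0| := fun i j => by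
    simp [EuclideanSpace.norm_eq, Real.sqrt_sq_eq_abs]
  have hpos : ∀ i j, i ≠ j → 0 < ‖x i - x j‖ := fun i j hij =>
    norm_pos_iff.2 (sub_ne_zero.2 (hx.ne hij))
  have hne : (Finset.univ.offDiag : Finset (Fin p × Fin p)).Nonempty :=
    ⟨(⟨0, by omega⟩, ⟨1, by omega⟩), by simp⟩
  obtain ⟨⟨m, k⟩, hmk, hmax⟩ := Finset.exists_max_image Finset.univ.offDiag
    (fun q : Fin p × Fin p => |U q.2| / ‖x q.1 - x q.2‖) hne
  simp only [Finset.mem_offDiag, Finset.mem_univ, true_and, Prod.forall] at hmk hmax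
  set M := |U k| / ‖x m - x k‖ with hM
  have hM0 : 0 ≤ M := by positivity
  have hsum : ∑ i, ∑ j ∈ Finset.univ.erase i, U j ^ 2 / ‖x i - x j‖ ^ 2 ≤ (p : ℝ) ^ 2 * M ^ 2 := by
    calc ∑ i, ∑ j ∈ Finset.univ.erase i, U j ^ 2 / ‖x i - x j‖ ^ 2
        ≤ ∑ _i : Fin p, ∑ _j : Fin p, M ^ 2 := by
          refine Finset.sum_le_sum fun i _ => ?_
          refine (Finset.sum_le_sum fun j hj => ?_).trans
            (Finset.sum_le_sum_of_subset_of_nonneg (Finset.erase_subset i _)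
              fun _ _ _ => sq_nonneg M)
          rw [← sq_abs (U j), ← div_pow]
          have := hmax i j (Finset.ne_of_mem_erase hj).symm
          gcongr
      _ = (p : ℝ) ^ 2 * M ^ 2 := by simp; ring
  have hc : τ ^ 2 / p ^ 2 * ∑ i, ∑ j ∈ Finset.univ.erase i, U j ^ 2 / ‖x i - x j‖ ^ 2 ≤
      τ ^ 2 * M ^ 2 := by
    calc _ ≤ τ ^ 2 / p ^ 2 * ((p : ℝ) ^ 2 * M ^ 2) := by gcongr
      _ = τ ^ 2 * M ^ 2 := by field_simp
  refine hc.trans ?_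
  have hsup : ∀ i, ‖vectorQuadForm (partialInvDistMatrix x i) U‖ ≤
      ⨆ k : Fin p, ‖vectorQuadForm (partialInvDistMatrix x k) U‖ := fun i =>
    le_ciSup (f := fun k : Fin p => ‖vectorQuadForm (partialInvDistMatrix x k) U‖)
      (Set.finite_range _).bddAbove i
  have hsup0 := (norm_nonneg _).trans (hsup k)
  have hsq0 := sq_nonneg ‖WithLp.toLp 2 (invDistMatrix x *ᵥ (U : Fin p → ℝ))‖
  rcases hM0.eq_or_lt with h0 | hMpos
  · rw [← h0]; linarith [mul_zero (τ ^ 2)]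
  obtain ⟨i, hi⟩ := exists_threshold_mul_lt hp (fun i => x i 0) U hxs hMpos
    (fun i j hij => by
      have := hmax i j hij
      rwa [div_le_iff₀ (hpos i j hij), hnorm] at this)
    (Ne.symm hmk) (by
      rw [hM, ← hnorm, norm_sub_rev (x k), div_mul_cancel₀ _ (hpos m k hmk).ne'])
  rcases hi with hi | hi
  · have h1 := PiLp.norm_apply_le (WithLp.toLp 2 (invDistMatrix x *ᵥ (U : Fin p → ℝ))) i
    rw [Real.norm_eq_abs, PiLp.toLp_apply, toLp_invDistMatrix_mulVec_apply] at h1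
    have h2 : (τ * M) ^ 2 ≤ ‖WithLp.toLp 2 (invDistMatrix x *ᵥ (U : Fin p → ℝ))‖ ^ 2 :=
      pow_le_pow_left₀ (by positivity) (hi.le.trans h1) 2
    rw [mul_pow] at h2
    linarith
  · have h1 := (PiLp.norm_apply_le (vectorQuadForm (partialInvDistMatrix x i) U) 0).trans (hsup i)
    rw [Real.norm_eq_abs, vectorQuadForm_partialInvDistMatrix_apply x hx, abs_mul, abs_neg,
      abs_two] at h1
    have h2 : τ ^ 2 * M ^ 2 ≤ τ * M ^ 2 := by
      gcongr; exact pow_le_of_le_one hτ0.le hτ1 two_ne_zero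
    have h3 := abs_nonneg (force (fun i => x i 0) U i)
    linarith
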